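/- Let $(a)_n=a(a+1)\cdots(a+n-1)$ and let ${}_2F_1(a,b;c;z)=\sum_{n\ge0}\frac{(a)_n(b)_n}{n!\,(c)_n}z^n$. Define $u(n)$ for $n\ge 0$ by the identity of formal power series $$\sum_{n\ge0}\frac{u(n)}{(2n+1)!}t^n=\frac{{}_2F_1\left(\tfrac34,\tfrac34;\tfrac32;4t\right)}{{}_2F_1\left(\tfrac14,\tfrac14;\tfrac12;4t\right)},$$ and set $$s(n,k)=\frac{(2n)!}{(2k)!}\,[z^{2n}]\left(\sum_{j\ge0}\frac{u(j)}{(2j+1)!}z^{2j+1}\right)^{2k}.$$ Let $p\equiv1\pmod 4$ be a prime and put $\Pi(p)=3^27^2\cdots(2p-3)^2=\prod_{i=1}^{(p-1)/2}(4i-1)^2$. Let $n\ge\frac{p+1}{2}$ and let $l$ be any integer. Then the numbers $s(n,k)$, $1\le k\le n$, are integers, and $$\sum_{\substack{1\le k\le n\\ k\equiv l\ (\mathrm{mod}\ (p-1)/2)}}2^{n-k}\,s(n,k)\left(-2^{\frac{p-1}{2}}\,\Pi(p)\right)^{\frac{2(k-l)}{p-1}}\equiv0\pmod p.$$ Here the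 exponents $\frac{2(k-l)}{p-1}$ are integers; negative powers are taken modulo $p$, the base being prime to $p$. -/

import Mathlib

namespace ThetaTaylor

/-- The formal Gauss hypergeometric series `₂F₁(a, b; c; z) = ∑ (a)ₙ (b)ₙ / (n! (c)ₙ) zⁿ` evaluated
at `z = r t`, as a formal power series in `t` over `ℚ`.
The Pochhammer symbol `(x)ₙ = x (x + 1) ⋯ (x + n - 1)` is `(ascPochhammer ℚ n).eval x`. -/
noncomputable def hyp (a b c r : ℚ) : PowerSeries ℚ :=
  PowerSeries.mk fun n =>
    ((ascPochhammer ℚ n).eval a * (ascPochhammer ℚ n).eval b) /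
      ((n.factorial : ℚ) * (ascPochhammer ℚ n).eval c) * r ^ n

/-- The sequence `u(n)`, given by
`∑ u(n) / (2n+1)! tⁿ = ₂F₁(3/4, 3/4; 3/2; 4t) / ₂F₁(1/4, 1/4; 1/2; 4t)`.
The denominator has constant coefficient `1`, so its inverse is the genuine one. -/
noncomputable def u (n : ℕ) : ℚ :=
  ((2 * n + 1).factorial : ℚ) *
    PowerSeries.coeff n (hyp (3 / 4) (3 / 4) (3 / 2) 4 * (hyp (1 / 4) (1 / 4) (1 / 2) 4)⁻¹)

/-- The odd power series `∑ u(j) / (2j+1)! z^(2j+1)`. -/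
noncomputable def uSeries : PowerSeries ℚ :=
  PowerSeries.mk fun m => if Odd m then u ((m - 1) / 2) / (m.factorial : ℚ) else 0

/-- The numbers `s(n, k) = (2n)! / (2k)! [z^(2n)] (∑ u(j) / (2j+1)! z^(2j+1))^(2k)`. -/
noncomputable def s (n k : ℕ) : ℚ :=
  ((2 * n).factorial : ℚ) / ((2 * k).factorial : ℚ) *
    PowerSeries.coeff (2 * n) (uSeries ^ (2 * k))

/-- `Π(p) = 3² 7² ⋯ (2p-3)² = ∏_{i=1}^{(p-1)/2} (4i-1)²`. -/
def bigPi (p : ℕ) : ℤ :=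
  ∏ i ∈ Finset.Icc 1 ((p - 1) / 2), (4 * (i : ℤ) - 1) ^ 2

end ThetaTaylor

/-! Let f = `uSeries`, D = d/dz, h = (p-1)/2. Then f = N/Q, where N and Q are the two hypergeometric
series in 4z² (N with an extra factor z). The exponential coefficients of N and Q are the integers
3²7²⋯(4n-1)² and 1²5²⋯(4n-3)², so f and all its divided powers f^m/m! are Hurwitz series (n!·aₙ
integral). This gives the integrality of s(n,k).

Modulo p, D^p Q ≡ 0 and D^p N ≡ Π(p) Q. Since D^p is a derivation modulo p, applying it to fQ = N
gives D^p f ≡ Π(p); also (Df)^p ≡ 1. Jacobson's formula (`iterate_prime_derivation_divPow`) then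
yields D^p(f^m/m!) ≡ Π(p) f^(m-1)/(m-1)! + f^(m-p)/(m-p)!. Taking m = 2k and the exponential
coefficient at 2n-p gives s(n,k) ≡ Π(p) t(k) + t(k-h). The weights in the theorem get multiplied by
-Π(p) when k becomes k+h, so the sum over a class modulo h telescopes to 0 (`sum_weighted_eq_zero`).
-/

namespace ThetaTaylor

/-! ### The p-th iterate of a derivation on divided powers, modulo p. -/

section Jacobson

variable {H A : Type*} [CommRing H] [CommRing A] (D : Derivation ℤ H H)

theorem iterate_derivation_mul (k : ℕ) (x y : H) :
    D^[k] (x * y) = ∑ ij ∈ Finset.HasAntidiagonal.antidiagonal k, (k.choose ij.1 : H) * (D^[ij.1] x * D^[ij.2] y) := by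
  induction k with
  | zero => simp
  | succ k ih =>
    have := Finset.sum_antidiagonal_choose_succ_mul (fun i j => D^[i] x * D^[j] y) k
    rw [this, Function.iterate_succ_apply', ih, map_sum, ← Finset.sum_add_distrib]
    refine Finset.sum_congr rfl fun ij hij => ?_
    have h : k.choose ij.2 = k.choose ij.1 := by
      rw [Finset.HasAntidiagonal.mem_antidiagonal] at hij
      exact (Nat.choose_symm_of_eq_add (by omega))
    rw [h, Derivation.leibniz, Derivation.leibniz, Derivation.map_natCast]
    simp only [Function.iterate_succ_apply', smul_eq_mul]
    ring

variable {p : ℕ} [hp : Fact p.Prime] (π : H →+* A) (hA : (p : A) = 0)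
include hA

/-- In the Leibniz expansion the inner binomials are divisible by p. -/
theorem iterate_prime_derivation_mul (x y : H) :
    π (D^[p] (x * y)) = π x * π (D^[p] y) + π (D^[p] x) * π y := by
  have hp0 := hp.out.pos
  rw [iterate_derivation_mul, map_sum, Finset.Nat.sum_antidiagonal_eq_sum_range_succ_mk,
    Finset.sum_range_succ]
  obtain ⟨q, hq⟩ : ∃ q, p = q + 1 := ⟨p - 1, by omega⟩
  have h0 : ∀ i ∈ Finset.range p, i ≠ 0 →
      π ((p.choose i : H) * (D^[i] x * D^[p - i] y)) = 0 := by
    intro i hi hi0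
    obtain ⟨c, hc⟩ := hp.out.dvd_choose_self hi0 (Finset.mem_range.1 hi)
    rw [map_mul, map_natCast, hc, Nat.cast_mul, hA, zero_mul, zero_mul]
  rw [Finset.sum_eq_single_of_mem 0 (Finset.mem_range.2 hp0) h0]
  simp

theorem iterate_prime_derivation_pow (x : H) (m : ℕ) :
    π (D^[p] (x ^ (m + 1))) = (m + 1 : ℕ) * (π x ^ m * π (D^[p] x)) := by
  induction m with
  | zero => simp
  | succ m ih =>
    rw [pow_succ, iterate_prime_derivation_mul D π hA, ih]
    push_cast
    rw [map_pow]
    ring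

theorem isUnit_factorial_of_lt {i : ℕ} (hi : i < p) : IsUnit (i.factorial : A) := by
  have h : IsCoprime (i.factorial : ℤ) (p : ℤ) := by
    rw [Nat.isCoprime_iff_coprime]
    exact (hp.out.coprime_factorial_of_lt hi).symm
  have := h.map (Int.castRingHom A)
  simpa [hA, isCoprime_zero_right] using this

omit hp hA

/-- The coefficients `Y k j` in Faà di Bruno's formula
`Dᵏ (ψ ∘ f) = ∑ⱼ Y k j · (ψ⁽ʲ⁾ ∘ f)`. -/
def faaCoeff (f : H) : ℕ → ℕ → H
  | 0, 0 => 1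
  | 0, _ + 1 => 0
  | k + 1, 0 => D (faaCoeff f k 0)
  | k + 1, j + 1 => D (faaCoeff f k (j + 1)) + D f * faaCoeff f k j

variable (f : H)

theorem faaCoeff_succ_zero (k : ℕ) : faaCoeff D f (k + 1) 0 = 0 := by
  induction k with
  | zero => simp [faaCoeff]
  | succ k ih => rw [faaCoeff, ih, map_zero]

theorem faaCoeff_succ_one (k : ℕ) : faaCoeff D f (k + 1) 1 = D^[k + 1] f := by
  induction k with
  | zero => simp [faaCoeff]
  | succ k ih =>
    rw [faaCoeff, ih, faaCoeff_succ_zero, mul_zero, add_zero, ← Function.iterate_succ_apply' (f := D)]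

theorem faaCoeff_of_lt {k j : ℕ} (h : k < j) : faaCoeff D f k j = 0 := by
  induction k generalizing j with
  | zero => obtain ⟨j, rfl⟩ := Nat.exists_eq_succ_of_ne_zero h.ne'; simp [faaCoeff]
  | succ k ih =>
    obtain ⟨j, rfl⟩ := Nat.exists_eq_succ_of_ne_zero (Nat.ne_zero_of_lt h)
    rw [faaCoeff, ih (by omega), ih (by omega)]; simp

theorem faaCoeff_self (k : ℕ) : faaCoeff D f k k = D f ^ k := by
  induction k with
  | zero => simp [faaCoeff]
  | succ k ih =>
    rw [faaCoeff, faaCoeff_of_lt D f (Nat.lt_succ_self k), ih, map_zero, zero_add, pow_succ']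

variable {f} {γ : ℕ → H} (hγ0 : γ 0 = 1) (hγ : ∀ m, D (γ (m + 1)) = D f * γ m)
include hγ0 hγ

theorem iterate_derivation_divPow (k m : ℕ) :
    D^[k] (γ m) = ∑ ji ∈ Finset.HasAntidiagonal.antidiagonal m, faaCoeff D f k ji.1 * γ ji.2 := by
  induction k generalizing m with
  | zero =>
    rw [Finset.sum_eq_single_of_mem (0, m) (by simp)]
    · simp [faaCoeff]
    · rintro ⟨j, i⟩ hji hne
      rw [Finset.HasAntidiagonal.mem_antidiagonal] at hji
      have : j ≠ 0 := by rintro rfl; apply hne; ext <;> simp_all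
      rw [faaCoeff_of_lt D f (by simp; omega), zero_mul]
  | succ k ih =>
    rw [Function.iterate_succ_apply', ih, map_sum]
    simp only [Derivation.leibniz, smul_eq_mul]
    rw [Finset.sum_add_distrib]
    cases m with
    | zero => simp [hγ0, faaCoeff]
    | succ m =>
      rw [Finset.Nat.sum_antidiagonal_succ', Finset.Nat.sum_antidiagonal_succ,
        Finset.Nat.sum_antidiagonal_succ]
      simp only [hγ0, hγ, faaCoeff, Derivation.map_one_eq_zero, mul_zero, add_mul,
        Finset.sum_add_distrib]
      have h : ∀ ji : ℕ × ℕ, faaCoeff D f k ji.1 * (D f * γ ji.2) =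
          D f * faaCoeff D f k ji.1 * γ ji.2 := fun _ => by ring
      simp only [h, mul_comm (γ _) (D _)]
      ring

variable (hγf : ∀ m, (m.factorial : H) * γ m = f ^ m)
include hγf hA hp

omit hγ0 hγ in
theorem iterate_prime_derivation_divPow_of_lt {i : ℕ} (hi : i + 1 < p) :
    π (D^[p] (γ (i + 1))) = π (D^[p] f) * π (γ i) := by
  have h := iterate_prime_derivation_pow D π hA f i
  rw [← hγf, iterate_prime_derivation_mul D π hA] at h
  have hc : D^[p] ((i + 1).factorial : H) = 0 := by
    obtain ⟨q, hq⟩ : ∃ q, p = q + 1 := ⟨p - 1, by have := hp.out.pos; omega⟩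
    rw [hq, Function.iterate_succ_apply, Derivation.map_natCast]
    exact iterate_map_zero D q
  rw [hc, map_zero, zero_mul, add_zero, ← map_pow, ← hγf, map_mul, map_natCast, map_natCast] at h
  refine (isUnit_factorial_of_lt hA hi).mul_left_cancel ?_
  rw [h, Nat.factorial_succ]; push_cast; ring

/-- For i < p, i! is invertible in `A`, so the power rule for D^p determines D^p(γ i) as D^p f · γ
(i-1). In the Faà di Bruno expansion this is the j = 1 term; the terms 2 ≤ j < i vanish by
induction, leaving the coefficient of γ 0 = 1. -/
theorem map_faaCoeff_prime {i : ℕ} (h2 : 2 ≤ i) (hi : i < p) : π (faaCoeff D f p i) = 0 := by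
  induction i using Nat.strong_induction_on with
  | _ i ih =>
    obtain ⟨m, rfl⟩ : ∃ m, i = m + 2 := ⟨i - 2, by omega⟩
    have h := iterate_prime_derivation_divPow_of_lt D π hA hγf (i := m + 1) hi
    obtain ⟨q, rfl⟩ : ∃ q, p = q + 1 := ⟨p - 1, by omega⟩
    rw [iterate_derivation_divPow D hγ0 hγ, Finset.Nat.sum_antidiagonal_succ,
      Finset.Nat.sum_antidiagonal_succ, Finset.Nat.sum_antidiagonal_eq_sum_range_succ_mk,
      Finset.sum_range_succ, faaCoeff_succ_zero, zero_mul, zero_add, zero_add, faaCoeff_succ_one,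
      map_add, map_add, map_mul, map_sum, Finset.sum_eq_zero] at h
    · simpa [hγ0] using h
    · intro j hj
      have hj := Finset.mem_range.1 hj
      rw [map_mul]
      simp only [add_assoc, Nat.reduceAdd]
      rw [ih (j + 2) (by omega) (by omega) (by omega), zero_mul]

/-- Jacobson's formula for `Dᵖ` on divided powers in characteristic `p`. -/
theorem iterate_prime_derivation_divPow (m : ℕ) :
    π (D^[p] (γ (m + 1))) = π (D^[p] f) * π (γ m) +
      if p ≤ m + 1 then π (D f) ^ p * π (γ (m + 1 - p)) else 0 := by
  have h2 := hp.out.two_le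
  -- Only the coefficients with j = 1 and j = p survive modulo p.
  have key : ∀ j, π (faaCoeff D f p (j + 2)) = if p = j + 2 then π (D f) ^ p else 0 := by
    intro j
    split_ifs with h
    · rw [← h, faaCoeff_self, map_pow]
    · rcases lt_or_gt_of_ne h with h | h
      · rw [faaCoeff_of_lt D f h, map_zero]
      · exact map_faaCoeff_prime D π hA hγ0 hγ hγf (by omega) h
  have h0 : faaCoeff D f p 0 = 0 := by
    obtain ⟨q, rfl⟩ : ∃ q, p = q + 1 := ⟨p - 1, by omega⟩
    exact faaCoeff_succ_zero D f q
  have h1 : faaCoeff D f p 1 = D^[p] f := by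
    obtain ⟨q, rfl⟩ : ∃ q, p = q + 1 := ⟨p - 1, by omega⟩
    exact faaCoeff_succ_one D f q
  rw [iterate_derivation_divPow D hγ0 hγ, Finset.Nat.sum_antidiagonal_succ, h0, zero_mul, zero_add]
  cases m with
  | zero =>
    rw [if_neg (by omega)]
    simp [h1]
  | succ m =>
    rw [Finset.Nat.sum_antidiagonal_succ, zero_add, h1, map_add, map_mul, map_sum]
    congr 1
    simp only [add_assoc, Nat.reduceAdd, map_mul, key, ite_mul, zero_mul]
    split_ifs with h
    · rw [Finset.sum_eq_single_of_mem (p - 2, m + 2 - p) (by simp; omega)]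
      · rw [if_pos (by simp; omega)]
      · rintro ⟨a, b⟩ hab hne
        rw [Finset.HasAntidiagonal.mem_antidiagonal] at hab
        rw [if_neg]
        rintro rfl
        apply hne
        simp only at hab
        simp only [Prod.mk.injEq]
        omega
    · refine Finset.sum_eq_zero fun ab hab => ?_
      rw [Finset.HasAntidiagonal.mem_antidiagonal] at hab
      rw [if_neg (by omega)]

end Jacobson

end ThetaTaylor

/-! ### Hurwitz series: integrality, divided powers, differentiation. -/

namespace ThetaTaylor
open PowerSeries

theorem factorial_mul_mul_mem_range {i j n : ℕ} (hij : i + j = n) {a b : ℚ}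
    (ha : (i.factorial : ℚ) * a ∈ (Int.castRingHom ℚ).range)
    (hb : (j.factorial : ℚ) * b ∈ (Int.castRingHom ℚ).range) :
    (n.factorial : ℚ) * (a * b) ∈ (Int.castRingHom ℚ).range := by
  have h : (n.factorial : ℚ) * (a * b) =
      (Int.castRingHom ℚ (n.choose j : ℤ)) * ((i.factorial * a) * (j.factorial * b)) := by
    have := Nat.add_choose_mul_factorial_mul_factorial i j
    rw [hij] at this
    rw [← this]; push_cast; simp; ring
  rw [h]
  exact mul_mem ⟨_, rfl⟩ (mul_mem ha hb)

/-- Power series over `ℚ` whose exponential coefficients `n! · aₙ` are integers. -/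
def hurwitz : Subring ℚ⟦X⟧ where
  carrier := {φ | ∀ n : ℕ, (n.factorial : ℚ) * coeff n φ ∈ (Int.castRingHom ℚ).range}
  zero_mem' := fun n => by simp
  one_mem' := fun n => by
    rw [coeff_one]
    split_ifs with h
    · subst h; simp
    · simp
  add_mem' := fun {a b} ha hb n => by
    rw [map_add, mul_add]; exact add_mem (ha n) (hb n)
  neg_mem' := fun {a} ha n => by
    rw [map_neg, mul_neg]; exact neg_mem (ha n)
  mul_mem' := fun {a b} ha hb n => by
    rw [coeff_mul, Finset.mul_sum]
    refine sum_mem fun ij hij => ?_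
    exact factorial_mul_mul_mem_range (Finset.HasAntidiagonal.mem_antidiagonal.1 hij) (ha _) (hb _)

theorem factorial_mul_coeff_derivative (φ : ℚ⟦X⟧) (n : ℕ) :
    (n.factorial : ℚ) * coeff n (derivative ℚ φ) = ((n + 1).factorial : ℚ) * coeff (n + 1) φ := by
  rw [coeff_derivative, Nat.factorial_succ]; push_cast; ring

theorem derivative_mem_hurwitz {φ : ℚ⟦X⟧} (h : φ ∈ hurwitz) : derivative ℚ φ ∈ hurwitz := fun n => by
  rw [factorial_mul_coeff_derivative]; exact h (n + 1)

theorem mem_hurwitz_of_derivative {φ : ℚ⟦X⟧} (h0 : constantCoeff φ = 0)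
    (h : derivative ℚ φ ∈ hurwitz) : φ ∈ hurwitz := by
  intro n
  cases n with
  | zero => simp [h0]
  | succ n => rw [← factorial_mul_coeff_derivative]; exact h n

theorem inv_mem_hurwitz {φ : ℚ⟦X⟧} (h0 : constantCoeff φ = 1) (h : φ ∈ hurwitz) :
    φ⁻¹ ∈ hurwitz := by
  intro n
  induction n using Nat.strong_induction_on with
  | _ n ih =>
    rw [PowerSeries.coeff_inv]
    split_ifs with hn
    · subst hn; simp [h0]
    · rw [h0, inv_one, neg_one_mul, mul_neg, Finset.mul_sum]
      refine neg_mem (sum_mem fun ij hij => ?_)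
      rw [Finset.HasAntidiagonal.mem_antidiagonal] at hij
      split_ifs with hlt
      · exact factorial_mul_mul_mem_range hij (h _) (ih _ hlt)
      · simp

/-- The divided power `φᵐ / m!`. -/
noncomputable def divPow (φ : ℚ⟦X⟧) (m : ℕ) : ℚ⟦X⟧ := ((m.factorial : ℚ)⁻¹) • φ ^ m

theorem factorial_mul_divPow (φ : ℚ⟦X⟧) (m : ℕ) :
    (m.factorial : ℚ⟦X⟧) * divPow φ m = φ ^ m := by
  have : (m.factorial : ℚ) ≠ 0 := by exact_mod_cast m.factorial_ne_zero
  rw [divPow, ← nsmul_eq_mul, ← Nat.cast_smul_eq_nsmul ℚ, smul_smul, mul_inv_cancel₀ this, one_smul]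

theorem derivative_divPow_succ (φ : ℚ⟦X⟧) (m : ℕ) :
    derivative ℚ (divPow φ (m + 1)) = derivative ℚ φ * divPow φ m := by
  have : (m.factorial : ℚ) ≠ 0 := by exact_mod_cast m.factorial_ne_zero
  have h1 : ((m : ℚ) + 1) ≠ 0 := by positivity
  rw [divPow, divPow, Derivation.map_smul, Derivation.leibniz_pow, ← Nat.cast_smul_eq_nsmul ℚ,
    smul_smul, smul_eq_mul, mul_smul_comm, Nat.factorial_succ, add_tsub_cancel_right, mul_comm (φ ^ m)]
  congr 1
  push_cast
  field_simp

/-- Integrate (φ^(m+1)/(m+1)!)' = φ' · φ^m/m!; integration without constant term only shifts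
exponential coefficients. -/
theorem divPow_mem_hurwitz {φ : ℚ⟦X⟧} (h0 : constantCoeff φ = 0) (h : φ ∈ hurwitz) (m : ℕ) :
    divPow φ m ∈ hurwitz := by
  induction m with
  | zero => simp [divPow]
  | succ m ih =>
    refine mem_hurwitz_of_derivative ?_ ?_
    · simp [divPow, h0]
    · rw [derivative_divPow_succ]; exact mul_mem (derivative_mem_hurwitz h) ih

/-- Differentiation on the ring of Hurwitz series. -/
noncomputable def hurwitzDeriv : Derivation ℤ hurwitz hurwitz where
  toFun φ := ⟨derivative ℚ φ.1, derivative_mem_hurwitz φ.2⟩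
  map_add' a b := by ext1; simp
  map_smul' a b := by ext1; simp
  map_one_eq_zero' := by ext1; simp
  leibniz' a b := by ext1; simp [Derivation.leibniz]

theorem factorial_mul_coeff_iterate_hurwitzDeriv (φ : hurwitz) (k n : ℕ) :
    (n.factorial : ℚ) * coeff n ((hurwitzDeriv^[k] φ : hurwitz) : ℚ⟦X⟧) =
      ((n + k).factorial : ℚ) * coeff (n + k) (φ : ℚ⟦X⟧) := by
  induction k generalizing n with
  | zero => rfl
  | succ k ih =>
    rw [Function.iterate_succ_apply', ← add_assoc, add_right_comm, ← ih (n + 1)]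
    exact factorial_mul_coeff_derivative _ n

theorem natCast_dvd_hurwitz {p : ℕ} (hp : p ≠ 0) {φ : hurwitz}
    (h : ∀ n : ℕ, ∃ z : ℤ, (n.factorial : ℚ) * coeff n (φ : ℚ⟦X⟧) = p * z) :
    (p : hurwitz) ∣ φ := by
  have hp' : (p : ℚ) ≠ 0 := by exact_mod_cast hp
  refine ⟨⟨(p : ℚ)⁻¹ • (φ : ℚ⟦X⟧), fun n => ?_⟩, ?_⟩
  · obtain ⟨z, hz⟩ := h n
    refine ⟨z, ?_⟩
    rw [coeff_smul, smul_eq_mul, mul_left_comm, hz]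
    simp [hp']
  · ext1
    simp only [Subring.coe_mul, Subring.coe_natCast]
    rw [← nsmul_eq_mul, ← Nat.cast_smul_eq_nsmul ℚ, smul_smul, mul_inv_cancel₀ hp', one_smul]

/-- The exponential coefficients of a Hurwitz series. -/
noncomputable def expCoeff (φ : hurwitz) (n : ℕ) : ℤ := (φ.2 n).choose

theorem cast_expCoeff (φ : hurwitz) (n : ℕ) :
    (expCoeff φ n : ℚ) = (n.factorial : ℚ) * coeff n (φ : ℚ⟦X⟧) := (φ.2 n).choose_spec

end ThetaTaylor

/-! ### The hypergeometric numerator and denominator of f. -/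

namespace ThetaTaylor
open PowerSeries

/-- `3² 7² ⋯ (4n-1)²`. -/
def numerCoeff (n : ℕ) : ℤ := ∏ i ∈ Finset.range n, (4 * (i : ℤ) + 3) ^ 2

/-- `1² 5² ⋯ (4n-3)²`. -/
def denomCoeff (n : ℕ) : ℤ := ∏ i ∈ Finset.range n, (4 * (i : ℤ) + 1) ^ 2

theorem coeff_hyp_succ (a b c r : ℚ) (hc : 0 < c) (n : ℕ) :
    (n + 1) * (c + n) * coeff (n + 1) (hyp a b c r) =
      (a + n) * (b + n) * r * coeff n (hyp a b c r) := by
  have h1 : (ascPochhammer ℚ n).eval c ≠ 0 := (ascPochhammer_pos n c hc).ne'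
  have h2 : (n.factorial : ℚ) ≠ 0 := by exact_mod_cast n.factorial_ne_zero
  have h3 : (c + n) ≠ 0 := by positivity
  have h4 : ((n : ℚ) + 1) ≠ 0 := by positivity
  simp only [hyp, coeff_mk, ascPochhammer_succ_eval, Nat.factorial_succ]
  push_cast
  field_simp
  ring

theorem factorial_mul_coeff_hyp_numer (n : ℕ) :
    ((2 * n + 1).factorial : ℚ) * coeff n (hyp (3 / 4) (3 / 4) (3 / 2) 4) = numerCoeff n := by
  induction n with
  | zero => simp [hyp, numerCoeff]
  | succ n ih =>
    have h := coeff_hyp_succ (3 / 4) (3 / 4) (3 / 2) 4 (by norm_num) n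
    rw [numerCoeff, Finset.prod_range_succ, ← numerCoeff, show 2 * (n + 1) + 1 = 2 * n + 1 + 1 + 1 by ring,
      Nat.factorial_succ, Nat.factorial_succ]
    push_cast
    rw [← ih]
    linear_combination (4 * ((2 * n + 1).factorial : ℚ)) * h

theorem factorial_mul_coeff_hyp_denom (n : ℕ) :
    ((2 * n).factorial : ℚ) * coeff n (hyp (1 / 4) (1 / 4) (1 / 2) 4) = denomCoeff n := by
  induction n with
  | zero => simp [hyp, denomCoeff]
  | succ n ih =>
    have h := coeff_hyp_succ (1 / 4) (1 / 4) (1 / 2) 4 (by norm_num) n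
    rw [denomCoeff, Finset.prod_range_succ, ← denomCoeff, show 2 * (n + 1) = 2 * n + 1 + 1 by ring,
      Nat.factorial_succ, Nat.factorial_succ]
    push_cast
    rw [← ih]
    linear_combination (4 * ((2 * n).factorial : ℚ)) * h

/-- `z ₂F₁(3/4, 3/4; 3/2; 4z²)`. -/
noncomputable def numer : ℚ⟦X⟧ := X * expand 2 two_ne_zero (hyp (3 / 4) (3 / 4) (3 / 2) 4)

/-- `₂F₁(1/4, 1/4; 1/2; 4z²)`. -/
noncomputable def denom : ℚ⟦X⟧ := expand 2 two_ne_zero (hyp (1 / 4) (1 / 4) (1 / 2) 4)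

theorem factorial_mul_coeff_numer (m : ℕ) :
    (m.factorial : ℚ) * coeff m numer = if Odd m then (numerCoeff (m / 2) : ℚ) else 0 := by
  rcases Nat.even_or_odd' m with ⟨c, rfl | rfl⟩
  · rw [if_neg (by simp)]
    cases c with
    | zero => simp [numer]
    | succ c =>
      rw [numer, show 2 * (c + 1) = 2 * c + 1 + 1 by ring, coeff_succ_X_mul, coeff_expand_of_not_dvd,
        mul_zero]
      omega
  · rw [if_pos (by simp), show (2 * c + 1) / 2 = c by omega, ← factorial_mul_coeff_hyp_numer, numer,
      coeff_succ_X_mul, coeff_expand_mul]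

theorem factorial_mul_coeff_denom (m : ℕ) :
    (m.factorial : ℚ) * coeff m denom = if Even m then (denomCoeff (m / 2) : ℚ) else 0 := by
  rcases Nat.even_or_odd' m with ⟨c, rfl | rfl⟩
  · rw [if_pos (by simp), show (2 * c) / 2 = c by omega, ← factorial_mul_coeff_hyp_denom, denom,
      coeff_expand_mul]
  · rw [if_neg (by simp), denom, coeff_expand_of_not_dvd, mul_zero]
    omega

theorem constantCoeff_hyp (a b c r : ℚ) : constantCoeff (hyp a b c r) = 1 := by
  rw [← coeff_zero_eq_constantCoeff_apply]; simp [hyp]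

theorem constantCoeff_denom : constantCoeff denom = 1 := by
  rw [denom, constantCoeff_expand, constantCoeff_hyp]

theorem uSeries_eq : uSeries = X * expand 2 two_ne_zero
    (hyp (3 / 4) (3 / 4) (3 / 2) 4 * (hyp (1 / 4) (1 / 4) (1 / 2) 4)⁻¹) := by
  ext m
  rcases Nat.even_or_odd' m with ⟨c, rfl | rfl⟩
  · rw [uSeries, coeff_mk, if_neg (by simp)]
    cases c with
    | zero => simp
    | succ c =>
      rw [show 2 * (c + 1) = 2 * c + 1 + 1 by ring, coeff_succ_X_mul, coeff_expand_of_not_dvd]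
      omega
  · have h : ((2 * c + 1).factorial : ℚ) ≠ 0 := by exact_mod_cast (2 * c + 1).factorial_ne_zero
    rw [uSeries, coeff_mk, if_pos (by simp), coeff_succ_X_mul, coeff_expand_mul,
      show (2 * c + 1 - 1) / 2 = c by omega, u, mul_div_cancel_left₀ _ h]

theorem uSeries_mul_denom : uSeries * denom = numer := by
  rw [uSeries_eq, denom, numer, mul_assoc, ← map_mul, mul_assoc, PowerSeries.inv_mul_cancel, mul_one]
  rw [constantCoeff_hyp]; exact one_ne_zero

theorem numer_mem_hurwitz : numer ∈ hurwitz := fun m => by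
  rw [factorial_mul_coeff_numer]
  split_ifs
  exacts [⟨_, rfl⟩, zero_mem _]

theorem denom_mem_hurwitz : denom ∈ hurwitz := fun m => by
  rw [factorial_mul_coeff_denom]
  split_ifs
  exacts [⟨_, rfl⟩, zero_mem _]

theorem denom_ne_zero : constantCoeff denom ≠ 0 := by
  rw [constantCoeff_denom]; exact one_ne_zero

theorem uSeries_mem_hurwitz : uSeries ∈ hurwitz := by
  have h : uSeries = numer * denom⁻¹ := by
    rw [← uSeries_mul_denom, mul_assoc, PowerSeries.mul_inv_cancel _ denom_ne_zero, mul_one]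
  rw [h]
  exact mul_mem numer_mem_hurwitz (inv_mem_hurwitz constantCoeff_denom denom_mem_hurwitz)

theorem constantCoeff_uSeries : constantCoeff uSeries = 0 := by
  rw [uSeries_eq]; simp

theorem coeff_one_uSeries : coeff 1 uSeries = 1 := by
  rw [uSeries_eq]
  refine (coeff_succ_X_mul 0 _).trans ?_
  rw [coeff_zero_eq_constantCoeff_apply,
    constantCoeff_expand, map_mul, PowerSeries.constantCoeff_inv, constantCoeff_hyp, constantCoeff_hyp,
    inv_one, mul_one]

theorem numerCoeff_half (p : ℕ) : numerCoeff ((p - 1) / 2) = bigPi p := by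
  rw [numerCoeff, bigPi, Finset.range_eq_Ico, ← Finset.Ico_succ_right_eq_Icc,
    Finset.prod_Ico_eq_prod_range, Finset.prod_Ico_eq_prod_range]
  refine Finset.prod_congr (by simp) fun i _ => ?_
  push_cast; ring

/-! ### Congruences modulo p for N, Q and f. -/

section Prime

variable {p : ℕ} [hpp : Fact p.Prime] (hp : p % 4 = 1)
include hp

omit hpp in
-- As p ≡ 1 mod 4, p itself is the factor 4i+1 with i = (p-1)/4.
theorem prime_dvd_denomCoeff {n : ℕ} (hn : (p + 1) / 2 ≤ n) : (p : ℤ) ∣ denomCoeff n := by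
  refine Dvd.dvd.trans ?_ (Finset.dvd_prod_of_mem _ (Finset.mem_range.2
    (show (p - 1) / 4 < n by omega)))
  refine dvd_pow ?_ two_ne_zero
  rw [show 4 * (((p - 1) / 4 : ℕ) : ℤ) + 1 = p by omega]

omit hpp in
-- The first h factors form Π(p); the later ones reduce by 4(i+h)+3 = 4i+1+2p.
theorem prime_dvd_numerCoeff_sub (n : ℕ) :
    (p : ℤ) ∣ numerCoeff (n + (p - 1) / 2) - bigPi p * denomCoeff n := by
  rw [add_comm, ← numerCoeff_half, numerCoeff, numerCoeff, Finset.prod_range_add, ← mul_sub]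
  refine Dvd.dvd.mul_left (Int.ModEq.dvd ?_) _
  rw [denomCoeff]
  refine Int.ModEq.prod fun i _ => Int.ModEq.pow 2 ((Int.modEq_iff_dvd).2 ⟨2, ?_⟩)
  omega

/-- A factor 4i-1 divisible by p lies strictly between 0 and 2p, so it equals p, contradicting p ≡ 1
mod 4. -/
theorem bigPi_ne_zero : (bigPi p : ZMod p) ≠ 0 := by
  rw [bigPi, Int.cast_prod, Finset.prod_ne_zero_iff]
  intro i hi
  rw [Finset.mem_Icc] at hi
  rw [Int.cast_pow]
  refine pow_ne_zero _ fun h => ?_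
  rw [ZMod.intCast_zmod_eq_zero_iff_dvd] at h
  obtain ⟨c, hc⟩ := h
  have hp2 := hpp.out.two_le
  have h1 : 0 < c := by
    by_contra hcon
    have : (p : ℤ) * c ≤ 0 := mul_nonpos_of_nonneg_of_nonpos (by omega) (by omega)
    omega
  have h2 : c < 2 := by
    by_contra hcon
    have : (p : ℤ) * 2 ≤ p * c := mul_le_mul_of_nonneg_left (by omega) (by omega)
    omega
  obtain rfl : c = 1 := by omega
  omega

/-- `∑ u(j) / (2j+1)! z^(2j+1)` as a Hurwitz series. -/
noncomputable def uHurwitz : hurwitz := ⟨uSeries, uSeries_mem_hurwitz⟩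

variable {A : Type*} [CommRing A] (π : hurwitz →+* A) (hA : (p : A) = 0)
include hA

omit hp hpp in
theorem map_eq_of_dvd {x y : hurwitz} (h : (p : hurwitz) ∣ x - y) : π x = π y := by
  obtain ⟨z, hz⟩ := h
  rw [← sub_eq_zero, ← map_sub, hz, map_mul, map_natCast, hA, zero_mul]

theorem map_iterate_hurwitzDeriv_uHurwitz :
    π (hurwitzDeriv^[p] uHurwitz) = (bigPi p : ℤ) := by
  set N : hurwitz := ⟨numer, numer_mem_hurwitz⟩ with hN
  set Q : hurwitz := ⟨denom, denom_mem_hurwitz⟩ with hQ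
  have hmul : uHurwitz * Q = N := Subtype.ext uSeries_mul_denom
  have hunit : Q * ⟨denom⁻¹, inv_mem_hurwitz constantCoeff_denom denom_mem_hurwitz⟩ = 1 :=
    Subtype.ext (PowerSeries.mul_inv_cancel _ denom_ne_zero)
  have hp0 := hpp.out.ne_zero
  have h1 : π (hurwitzDeriv^[p] Q) = 0 := by
    rw [← map_zero π]
    refine map_eq_of_dvd π hA (natCast_dvd_hurwitz hp0 fun n => ?_)
    rw [sub_zero, factorial_mul_coeff_iterate_hurwitzDeriv, hQ, factorial_mul_coeff_denom]
    split_ifs with h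
    · obtain ⟨z, hz⟩ := prime_dvd_denomCoeff hp (n := (n + p) / 2) (by
        rw [Nat.even_iff] at h; omega)
      exact ⟨z, by rw [hz]; push_cast; rfl⟩
    · exact ⟨0, by simp⟩
  have h2 : π (hurwitzDeriv^[p] N) = π ((bigPi p : ℤ) * Q) := by
    refine map_eq_of_dvd π hA (natCast_dvd_hurwitz hp0 fun n => ?_)
    have hcoe : (((hurwitzDeriv^[p] N - (bigPi p : ℤ) * Q : hurwitz)) : ℚ⟦X⟧) =
        (hurwitzDeriv^[p] N : hurwitz) - (bigPi p : ℚ) • denom := by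
      rw [Int.cast_smul_eq_zsmul, zsmul_eq_mul]; simp [hQ]
    rw [hcoe, map_sub, mul_sub, factorial_mul_coeff_iterate_hurwitzDeriv, hN,
      factorial_mul_coeff_numer, coeff_smul, smul_eq_mul, mul_left_comm, factorial_mul_coeff_denom]
    by_cases h : Even n
    · have h' : Odd (n + p) := h.add_odd (by rw [Nat.odd_iff]; omega)
      obtain ⟨z, hz⟩ := prime_dvd_numerCoeff_sub hp (n / 2)
      rw [if_pos h, if_pos h', show (n + p) / 2 = n / 2 + (p - 1) / 2 by
        rw [Nat.even_iff] at h; omega]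
      exact ⟨z, by exact_mod_cast hz⟩
    · have h' : ¬ Odd (n + p) := by
        rw [Nat.not_even_iff] at h
        rw [Nat.odd_iff]; omega
      rw [if_neg h, if_neg h']
      exact ⟨0, by simp⟩
  rw [← hmul, iterate_prime_derivation_mul hurwitzDeriv π hA, h1, mul_zero, zero_add, map_mul,
    map_intCast] at h2
  -- Now D^p f · Q ≡ Π(p) Q, and Q is a unit since it has constant term 1.
  have hu : IsUnit (π Q) := IsUnit.of_mul_eq_one _ (by rw [← map_mul, hunit, map_one])
  exact hu.mul_right_cancel h2

omit hp in
-- Write f' = 1 + g with g(0) = 0. Then g^p = p!·(g^p/p!) is divisible by p among Hurwitz series,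
-- and (1+g)^p ≡ 1 + g^p.
theorem map_hurwitzDeriv_uHurwitz_pow : π (hurwitzDeriv uHurwitz) ^ p = 1 := by
  set g : hurwitz := hurwitzDeriv uHurwitz - 1 with hg
  have hg0 : constantCoeff (g : ℚ⟦X⟧) = 0 := by
    rw [hg, ← coeff_zero_eq_constantCoeff_apply]
    have h : coeff 0 (derivative ℚ uSeries) = 1 := by
      rw [coeff_derivative]; simp [coeff_one_uSeries]
    have h' : (((hurwitzDeriv uHurwitz - 1 : hurwitz)) : ℚ⟦X⟧) = derivative ℚ uSeries - 1 := rfl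
    rw [h', map_sub, h]; simp
  have hgp : π (g ^ p) = 0 := by
    have h : g ^ p = (p.factorial : hurwitz) * ⟨divPow g p, divPow_mem_hurwitz hg0 g.2 p⟩ :=
      Subtype.ext (by simp [factorial_mul_divPow])
    rw [h, map_mul, map_natCast, ← Nat.mul_factorial_pred hpp.out.ne_zero, Nat.cast_mul, hA]
    simp
  obtain ⟨r, hr⟩ := exists_add_pow_prime_eq hpp.out g 1
  have : hurwitzDeriv uHurwitz = g + 1 := by rw [hg]; ring
  rw [this, ← map_pow, hr]
  simp [hgp, hA]

end Prime

end ThetaTaylor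

/-! ### The recurrence for s(n,k) modulo p and the telescoping sum. -/

namespace ThetaTaylor
open PowerSeries

/-- The divided power `fᵐ / m!` of `f = ∑ u(j) / (2j+1)! z^(2j+1)`. -/
noncomputable def uDivPow (m : ℕ) : hurwitz :=
  ⟨divPow uSeries m, divPow_mem_hurwitz constantCoeff_uSeries uSeries_mem_hurwitz m⟩

theorem coe_uDivPow (m : ℕ) :
    (uDivPow m : ℚ⟦X⟧) = ((m.factorial : ℚ)⁻¹) • uSeries ^ m := rfl

theorem expCoeff_uDivPow_two_mul (n k : ℕ) : (expCoeff (uDivPow (2 * k)) (2 * n) : ℚ) = s n k := by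
  rw [cast_expCoeff, coe_uDivPow, s, coeff_smul, smul_eq_mul, div_eq_mul_inv, mul_assoc]

theorem expCoeff_uDivPow_of_lt {N m : ℕ} (h : N < m) : expCoeff (uDivPow m) N = 0 := by
  have h0 : coeff N (uSeries ^ m) = 0 :=
    coeff_of_lt_order N (lt_of_lt_of_le (by exact_mod_cast h)
      (le_order_pow_of_constantCoeff_eq_zero m constantCoeff_uSeries))
  have : (expCoeff (uDivPow m) N : ℚ) = 0 := by
    rw [cast_expCoeff, coe_uDivPow, coeff_smul, h0, smul_zero, mul_zero]
  exact_mod_cast this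

theorem expCoeff_add (x y : hurwitz) (n : ℕ) : expCoeff (x + y) n = expCoeff x n + expCoeff y n := by
  have : (expCoeff (x + y) n : ℚ) = (expCoeff x n + expCoeff y n : ℤ) := by
    push_cast; simp only [cast_expCoeff, Subring.coe_add, map_add]; ring
  exact_mod_cast this

theorem expCoeff_intCast_mul (a : ℤ) (x : hurwitz) (n : ℕ) :
    expCoeff (a * x) n = a * expCoeff x n := by
  have : (expCoeff (a * x) n : ℚ) = (a * expCoeff x n : ℤ) := by
    push_cast
    rw [cast_expCoeff, cast_expCoeff, Subring.coe_mul, Subring.coe_intCast, ← zsmul_eq_mul,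
      ← Int.cast_smul_eq_zsmul ℚ, coeff_smul, smul_eq_mul, mul_left_comm]
  exact_mod_cast this

theorem expCoeff_zero (n : ℕ) : expCoeff 0 n = 0 := by
  simpa using expCoeff_intCast_mul 0 0 n

theorem expCoeff_iterate_hurwitzDeriv (x : hurwitz) (k n : ℕ) :
    expCoeff (hurwitzDeriv^[k] x) n = expCoeff x (n + k) := by
  have : (expCoeff (hurwitzDeriv^[k] x) n : ℚ) = expCoeff x (n + k) := by
    rw [cast_expCoeff, cast_expCoeff, factorial_mul_coeff_iterate_hurwitzDeriv]
  exact_mod_cast this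

/-- Modulo `p`, `(fᵐ⁺¹ / (m+1)!)⁽ᵖ⁾ ≡ Π(p) fᵐ / m! + fᵐ⁺¹⁻ᵖ / (m+1-p)!`. -/
theorem expCoeff_uDivPow_add_prime {p : ℕ} [hpp : Fact p.Prime] (hp : p % 4 = 1) (N m : ℕ) :
    (expCoeff (uDivPow (m + 1)) (N + p) : ZMod p) =
      bigPi p * expCoeff (uDivPow m) N +
        if p ≤ m + 1 then (expCoeff (uDivPow (m + 1 - p)) N : ZMod p) else 0 := by
  set π := Ideal.Quotient.mk (Ideal.span {(p : hurwitz)}) with hπ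
  have hA : ((p : ℕ) : hurwitz ⧸ Ideal.span {(p : hurwitz)}) = 0 := by
    rw [← map_natCast π, hπ, Ideal.Quotient.eq_zero_iff_mem]
    exact Ideal.mem_span_singleton_self _
  have h0 : uDivPow 0 = 1 := Subtype.ext (by simp [uDivPow, divPow])
  have h1 : ∀ m, hurwitzDeriv (uDivPow (m + 1)) = hurwitzDeriv uHurwitz * uDivPow m :=
    fun m => Subtype.ext (derivative_divPow_succ uSeries m)
  have h2 : ∀ m, (m.factorial : hurwitz) * uDivPow m = uHurwitz ^ m := fun m =>
    Subtype.ext (by simpa using! factorial_mul_divPow uSeries m)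
  have key := iterate_prime_derivation_divPow hurwitzDeriv π hA h0 h1 h2 m
  rw [map_iterate_hurwitzDeriv_uHurwitz hp π hA, map_hurwitzDeriv_uHurwitz_pow π hA, one_mul] at key
  have key' : π (hurwitzDeriv^[p] (uDivPow (m + 1))) =
      π ((bigPi p : ℤ) * uDivPow m + if p ≤ m + 1 then uDivPow (m + 1 - p) else 0) := by
    rw [key, map_add, map_mul, map_intCast]
    split_ifs <;> simp
  rw [hπ, Ideal.Quotient.eq, Ideal.mem_span_singleton] at key'
  obtain ⟨r, hr⟩ := key'
  have hr' : hurwitzDeriv^[p] (uDivPow (m + 1)) = ((p : ℤ) : hurwitz) * r +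
      ((bigPi p : ℤ) * uDivPow m + if p ≤ m + 1 then uDivPow (m + 1 - p) else 0) := by
    rw [Int.cast_natCast, ← hr]; ring
  have hfin := congrArg (fun x => (expCoeff x N : ZMod p)) hr'
  simp only [expCoeff_iterate_hurwitzDeriv, expCoeff_add, expCoeff_intCast_mul, Int.cast_add,
    Int.cast_mul] at hfin
  rw [Int.cast_natCast (R := ZMod p), CharP.cast_eq_zero, zero_mul, zero_add] at hfin
  rw [hfin]
  split_ifs <;> simp [expCoeff_zero]

/-- If `b k ≡ P t k + t (k - h)`, the sum of the `b k` over a residue class modulo `h`, weighted by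
`2^(n-k) (-2^h P)^((k-l)/h)`, telescopes to `0`. -/
theorem sum_weighted_eq_zero {F : Type*} [Field F] (h2 : (2 : F) ≠ 0) {P : F} (hP : P ≠ 0) {h n : ℕ}
    (hh : 0 < h) (hn : h ≤ n) (l : ℤ) (b t : ℕ → F)
    (ht : ∀ k, n - h < k → t k = 0)
    (hb : ∀ k, 1 ≤ k → b k = P * t k + if h < k then t (k - h) else 0) :
    ∑ k ∈ (Finset.Icc 1 n).filter (fun k : ℕ => (k : ℤ) ≡ l [ZMOD (h : ℤ)]),
      (2 : F) ^ (n - k) * b k * (-2 ^ h * P) ^ (((k : ℤ) - l) / h) = 0 := by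
  have hC : -2 ^ h * P ≠ 0 := mul_ne_zero (neg_ne_zero.2 (pow_ne_zero _ h2)) hP
  have hh' : (h : ℤ) ≠ 0 := by omega
  set w : ℕ → F := fun k => 2 ^ (n - k) * (-2 ^ h * P) ^ (((k : ℤ) - l) / h) with hw
  -- A shift by h removes 2^h from the power of 2 and contributes one factor -2^h P.
  have hwh : ∀ k, k + h ≤ n → w (k + h) = -P * w k := by
    intro k hk
    have e1 : (((k + h : ℕ) : ℤ) - l) / h = ((k : ℤ) - l) / h + 1 := by
      rw [show ((k + h : ℕ) : ℤ) - l = (k : ℤ) - l + h by push_cast; ring,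
        Int.add_ediv_of_dvd_right dvd_rfl, Int.ediv_self hh']
    simp only [hw]
    rw [e1, zpow_add_one₀ hC, show n - k = n - (k + h) + h by omega, pow_add]
    ring
  have hsplit : ∀ k ∈ (Finset.Icc 1 n).filter (fun k : ℕ => (k : ℤ) ≡ l [ZMOD (h : ℤ)]),
      (2 : F) ^ (n - k) * b k * (-2 ^ h * P) ^ (((k : ℤ) - l) / h) =
        P * (w k * t k) + if h < k then w k * t (k - h) else 0 := by
    intro k hk
    rw [Finset.mem_filter, Finset.mem_Icc] at hk
    rw [hb k hk.1.1]
    simp only [hw]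
    split_ifs <;> ring
  rw [Finset.sum_congr rfl hsplit, Finset.sum_add_distrib, ← Finset.mul_sum, ← Finset.sum_filter]
  -- Dropping the zero terms k > n-h matches the index range of the shifted sum `hB`.
  have hA : ∑ k ∈ (Finset.Icc 1 n).filter (fun k : ℕ => (k : ℤ) ≡ l [ZMOD (h : ℤ)]), w k * t k =
      ∑ k ∈ (Finset.Icc 1 (n - h)).filter (fun k : ℕ => (k : ℤ) ≡ l [ZMOD (h : ℤ)]), w k * t k := by
    refine (Finset.sum_subset (fun k hk => ?_) fun k hk hk' => ?_).symm
    · simp only [Finset.mem_filter, Finset.mem_Icc] at hk ⊢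
      exact ⟨⟨hk.1.1, by omega⟩, hk.2⟩
    · simp only [Finset.mem_filter, Finset.mem_Icc, not_and] at hk hk'
      have : n - h < k := by
        by_contra hcon
        exact hk' ⟨hk.1.1, by omega⟩ hk.2
      rw [ht k this, mul_zero]
  have hB : ∑ k ∈ ((Finset.Icc 1 n).filter (fun k : ℕ => (k : ℤ) ≡ l [ZMOD (h : ℤ)])).filter
        (fun k => h < k), w k * t (k - h) =
      ∑ k ∈ (Finset.Icc 1 (n - h)).filter (fun k : ℕ => (k : ℤ) ≡ l [ZMOD (h : ℤ)]),
        -P * (w k * t k) := by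
    symm
    refine Finset.sum_nbij' (fun k => k + h) (fun k => k - h) ?_ ?_ ?_ ?_ ?_
    · intro k hk
      simp only [Finset.mem_filter, Finset.mem_Icc] at hk ⊢
      refine ⟨⟨by omega, ?_⟩, by omega⟩
      push_cast
      exact Int.add_modulus_modEq_iff.2 hk.2
    · intro k hk
      simp only [Finset.mem_filter, Finset.mem_Icc] at hk ⊢
      refine ⟨by omega, ?_⟩
      rw [Nat.cast_sub (by omega)]
      refine Int.ModEq.trans ?_ hk.1.2
      exact (Int.modEq_iff_dvd).2 ⟨1, by ring⟩
    · intro k _; simp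
    · intro k hk
      simp only [Finset.mem_filter] at hk
      omega
    · intro k hk
      simp only [Finset.mem_filter, Finset.mem_Icc] at hk
      rw [hwh k (by omega), Nat.add_sub_cancel]; ring
  rw [hA, hB, ← Finset.mul_sum]
  ring

end ThetaTaylor

theorem lemma4p4 (p : ℕ) [Fact p.Prime] (hp : p % 4 = 1) (n : ℕ) (hn : (p + 1) / 2 ≤ n) (l : ℤ) :
    ∃ S : ℕ → ℤ, (∀ k ∈ Finset.Icc 1 n, (S k : ℚ) = ThetaTaylor.s n k) ∧
      ∑ k ∈ (Finset.Icc 1 n).filter (fun k : ℕ => (k : ℤ) ≡ l [ZMOD (((p - 1) / 2 : ℕ) : ℤ)]),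
        (2 : ZMod p) ^ (n - k) * (S k : ZMod p) *
          (-2 ^ ((p - 1) / 2) * (ThetaTaylor.bigPi p : ZMod p)) ^
            (2 * ((k : ℤ) - l) / ((p : ℤ) - 1)) = 0 := by
  have hp2 := (Fact.out : p.Prime).two_le
  refine ⟨fun k => ThetaTaylor.expCoeff (ThetaTaylor.uDivPow (2 * k)) (2 * n),
    fun k _ => ThetaTaylor.expCoeff_uDivPow_two_mul n k, ?_⟩
  have h2 : (2 : ZMod p) ≠ 0 := by
    intro h
    have h' : ((2 : ℕ) : ZMod p) = 0 := by exact_mod_cast h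
    rw [ZMod.natCast_eq_zero_iff] at h'
    have := Nat.le_of_dvd (by norm_num) h'
    omega
  have hexp : ∀ k : ℕ, 2 * ((k : ℤ) - l) / ((p : ℤ) - 1) = ((k : ℤ) - l) / (((p - 1) / 2 : ℕ) : ℤ) := by
    intro k
    rw [show (p : ℤ) - 1 = 2 * (((p - 1) / 2 : ℕ) : ℤ) by omega, Int.mul_ediv_mul_of_pos _ _ two_pos]
  simp only [hexp]
  -- Here t(k) is the coefficient of f^(2k-1)/(2k-1)! at 2n-p; it vanishes for k > n-h because f^m
  -- starts in degree m.
  refine ThetaTaylor.sum_weighted_eq_zero h2 (ThetaTaylor.bigPi_ne_zero hp) (by omega) (by omega) l _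
    (fun k => (ThetaTaylor.expCoeff (ThetaTaylor.uDivPow (2 * k - 1)) (2 * n - p) : ZMod p)) ?_ ?_
  · intro k hk
    rw [ThetaTaylor.expCoeff_uDivPow_of_lt (by omega), Int.cast_zero]
  · intro k hk
    have h := ThetaTaylor.expCoeff_uDivPow_add_prime hp (2 * n - p) (2 * k - 1)
    rw [show 2 * k - 1 + 1 = 2 * k by omega, show 2 * n - p + p = 2 * n by omega] at h
    rw [h]
    congr 1
    -- Since p is odd, p ≤ 2k exactly when h < k, and then 2k-p = 2(k-h)-1.
    by_cases hc : (p - 1) / 2 < k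
    · rw [if_pos hc, if_pos (by omega), show 2 * k - p = 2 * (k - (p - 1) / 2) - 1 by omega]
    · rw [if_neg hc, if_neg (by omega)]
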